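/- Let $n, k$ be positive integers and let $c_1,\dots,c_n$ be non-negative integers with $n=c_1+2c_2+\cdots+nc_n$. A permutation of $\{1,\dots,n\}$ has cycle type $\mathbf c=(c_1,\dots,c_n)$ if it has exactly $c_i$ cycles of length $i$ for each $1\le i\le n$ (fixed points being cycles of length $1$). A $k$th root of a permutation $\sigma\in S_n$ is a $\tau\in S_n$ with $\tau^k=\sigma$; let $\operatorname{re}_k(\sigma)$ and $\operatorname{ro}_k(\sigma)$ denote the numbers of $k$th roots of $\sigma$ that are even, respectively odd, permutations. For $\ell\ge 1$ put $G_k(\ell)=\{g\in\mathbb Z_{\ge 1} : \gcd(g\ell,k)=g\}$. Then permutations of $\{1,\dots,n\}$ of cycle type $\mathbf c$ exist, and for every such permutation $\sigma$ the difference $\operatorname{re}_k(\sigma)-\operatorname{ro}_k(\sigma)$ is equal to the coefficient of $$\frac{t_1^{c_1}\cdots t_n^{c_n}}{c_1!\cdots c_n!}$$ in the formal power series $$\exp\left(\sum_{\ell\ge 1}\ \sum_{g\in G_k(\ell)}(-1)^{\ell g+1}\,\frac{\ell^{g-1}}{g}\,t_\ell^{g}\right)$$ in the variables $t_1,t_2,t_3,\dots$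 over $\mathbb Q$. -/

import Mathlib

open scoped MvPowerSeries.WithPiTopology

namespace PermRoots

/-- `G_k(ℓ) = {g ∈ ℕ : g ≥ 1, gcd(gℓ, k) = g}`. -/
def G (k ℓ : ℕ) : Set ℕ := {g | 0 < g ∧ Nat.gcd (g * ℓ) k = g}

theorem G_finite {k : ℕ} (hk : 0 < k) (ℓ : ℕ) : (G k ℓ).Finite :=
  (Set.finite_Iic k).subset fun g hg => Nat.le_of_dvd hk (hg.2 ▸ Nat.gcd_dvd_right (g * ℓ) k)

/-- The number of even `k`th roots of a permutation `σ`. -/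
def re {n : ℕ} (k : ℕ) (σ : Equiv.Perm (Fin n)) : ℕ :=
  (Finset.univ.filter fun τ : Equiv.Perm (Fin n) => τ ^ k = σ ∧ Equiv.Perm.sign τ = 1).card

/-- The number of odd `k`th roots of a permutation `σ`. -/
def ro {n : ℕ} (k : ℕ) (σ : Equiv.Perm (Fin n)) : ℕ :=
  (Finset.univ.filter fun τ : Equiv.Perm (Fin n) => τ ^ k = σ ∧ Equiv.Perm.sign τ = -1).card

/-- `σ` has cycle type `(c₁, …, cₙ)`: it has exactly `cᵢ` cycles of length `i` for each
`1 ≤ i ≤ n`, fixed points being cycles of length one. The number `cᵢ` is stored at position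
`i - 1` of `Fin n`; the parts of `σ.partition` are the cycle lengths, fixed points included. -/
def HasCycleType {n : ℕ} (σ : Equiv.Perm (Fin n)) (c : Fin n → ℕ) : Prop :=
  ∀ i : Fin n, σ.partition.parts.count ((i : ℕ) + 1) = c i

/-- The polynomial `∑_{g ∈ G_k(ℓ)} (-1)^(ℓg+1) (ℓ^(g-1)/g) t_ℓ^g`, as an element of the ring
of formal power series over `ℚ` in the variables `t₁, t₂, t₃, …`. -/
noncomputable def inner (k : ℕ) (ℓ : ℕ+) : MvPowerSeries ℕ+ ℚ :=
  ∑ᶠ g ∈ G k ℓ,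
    MvPowerSeries.C ((-1 : ℚ) ^ ((ℓ : ℕ) * g + 1) * ((ℓ : ℚ) ^ (g - 1) / (g : ℚ))) *
      MvPowerSeries.X ℓ ^ g

/-- The formal power series `∑_{ℓ ≥ 1} ∑_{g ∈ G_k(ℓ)} (-1)^(ℓg+1) (ℓ^(g-1)/g) t_ℓ^g`. -/
noncomputable def exponent (k : ℕ) : MvPowerSeries ℕ+ ℚ :=
  ∑' ℓ : ℕ+, inner k ℓ

theorem coeff_inner_eq_zero {k : ℕ} (hk : 0 < k) {ℓ : ℕ+} {d : ℕ+ →₀ ℕ} (hd : d ℓ = 0) :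
    MvPowerSeries.coeff d (inner k ℓ) = 0 := by
  classical
  rw [inner, finsum_mem_eq_finite_toFinset_sum _ (G_finite hk ℓ), map_sum]
  refine Finset.sum_eq_zero fun g hg => ?_
  have hg : 0 < g := ((Set.Finite.mem_toFinset _).1 hg).1
  rw [MvPowerSeries.coeff_C_mul, MvPowerSeries.coeff_X_pow, if_neg, mul_zero]
  rintro rfl
  simp at hd
  omega

/-- The outer infinite sum converges (each coefficient of it is a finite sum). -/
theorem hasSum_inner {k : ℕ} (hk : 0 < k) : HasSum (inner k) (exponent k) := by
  refine Summable.hasSum ⟨fun d => ∑ ℓ ∈ d.support, MvPowerSeries.coeff d (inner k ℓ), ?_⟩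
  refine (MvPowerSeries.WithPiTopology.hasSum_iff_hasSum_coeff).2 fun d => ?_
  exact hasSum_sum_of_ne_finset_zero fun ℓ hℓ =>
    coeff_inner_eq_zero hk (Finsupp.notMem_support_iff.1 hℓ)

/-- The exponent has zero constant term, so that it may be substituted into the series `exp`. -/
theorem hasSubst_exponent {k : ℕ} (hk : 0 < k) : PowerSeries.HasSubst (exponent k) := by
  apply PowerSeries.HasSubst.of_constantCoeff_zero
  have h := (MvPowerSeries.WithPiTopology.hasSum_iff_hasSum_coeff).1 (hasSum_inner hk) 0
  have h0 : (fun ℓ : ℕ+ => MvPowerSeries.coeff (0 : ℕ+ →₀ ℕ) (inner k ℓ)) = fun _ => 0 :=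
    funext fun ℓ => coeff_inner_eq_zero hk rfl
  rw [h0] at h
  exact h.unique hasSum_zero

/-- The series `exp (∑_{ℓ ≥ 1} ∑_{g ∈ G_k(ℓ)} (-1)^(ℓg+1) (ℓ^(g-1)/g) t_ℓ^g)`. -/
noncomputable def genSeries (k : ℕ) : MvPowerSeries ℕ+ ℚ :=
  (PowerSeries.exp ℚ).subst (exponent k)

/-- The exponent vector of the monomial `t₁^c₁ ⋯ tₙ^cₙ`. -/
noncomputable def monomialExp {n : ℕ} (c : Fin n → ℕ) : ℕ+ →₀ ℕ :=
  ∑ i : Fin n, Finsupp.single (Nat.succPNat i) (c i)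

/-- The coefficient of `(t₁^c₁ ⋯ tₙ^cₙ) / (c₁! ⋯ cₙ!)` in the power series `F`. -/
noncomputable def egfCoeff {n : ℕ} (c : Fin n → ℕ) (F : MvPowerSeries ℕ+ ℚ) : ℚ :=
  (∏ i : Fin n, (Nat.factorial (c i) : ℚ)) * MvPowerSeries.coeff (monomialExp c) F

end PermRoots

namespace PermRoots

open Finset Function

/-! Raising to the `k`th power turns an `m`-cycle into `g = gcd(m,k)` cycles of length `ℓ = m/g`, so
the type of `τ ^ k` depends only on the type `p` of `τ`, and so does the sign of `τ`. The signed
root count is a class function. Summing it over the class of `σ` and counting classes as `N!/z_p`,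
where `z_p` is the centralizer order, gives `z_σ ∑ sgn(p)/z_p` over the types `p` whose `k`th power
has the type of `σ` (`signedRoots_eq`).

On the series side, pairs `(ℓ, g)` with `g ∈ G_k(ℓ)` correspond to integers `m = gℓ`
(`coeff_inner`), so the exponent has one monomial `(-1)^(m+1) (ℓ^g/m) t_ℓ^g` for each `m ≥ 1`.
Expanding `exp` gives a sum over multiplicities of the `m`, that is, over partitions
(`coeff_genSeries`). The factors `ℓ^g` multiply to the product of the cycle lengths of `σ`, the same
for every `p` in the sum (`prod_cycleCoeff`); it is the part of `z_σ` other than `∏ cᵢ!`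
(`centralizerCard_eq`). -/

theorem minimalPeriod_pos {α : Type*} [Finite α] (σ : Equiv.Perm α) (x : α) : 0 < minimalPeriod σ x := by
  refine IsPeriodicPt.minimalPeriod_pos (orderOf_pos σ) ?_
  rw [IsPeriodicPt, IsFixedPt, Equiv.Perm.iterate_eq_pow, pow_orderOf_eq_one]
  rfl

/-! ### Cycle lengths as minimal periods -/

section Perm

variable {α : Type*} [Fintype α] [DecidableEq α]

/-- Both numbers divide exactly those `a` for which `σ ^ a` fixes `x`. -/
theorem card_support_cycleOf (σ : Equiv.Perm α) {x : α} (hx : σ x ≠ x) :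
    (σ.cycleOf x).support.card = minimalPeriod σ x := by
  have hc := Equiv.Perm.isCycle_cycleOf σ hx
  rw [← hc.orderOf, ← Nat.dvd_right_iff_eq]
  intro a
  rw [orderOf_dvd_iff_pow_eq_one, ← isPeriodicPt_iff_minimalPeriod_dvd,
    hc.pow_eq_one_iff' (x := x) (by simpa using hx), Equiv.Perm.cycleOf_pow_apply_self,
    IsPeriodicPt, IsFixedPt, Equiv.Perm.iterate_eq_pow]

theorem minimalPeriod_le_card (σ : Equiv.Perm α) (x : α) :
    minimalPeriod σ x ≤ Fintype.card α := by
  by_cases hx : σ x = x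
  · rw [minimalPeriod_eq_one_iff_isFixedPt.2 hx]
    exact Fintype.card_pos_iff.2 ⟨x⟩
  · rw [← card_support_cycleOf σ hx]
    exact Finset.card_le_univ _

/-- The points of period `ℓ` are those on the `ℓ`-cycles. -/
theorem card_minimalPeriod_eq (σ : Equiv.Perm α) (ℓ : ℕ) :
    (univ.filter fun x => minimalPeriod σ x = ℓ).card = ℓ * σ.partition.parts.count ℓ := by
  rcases Nat.lt_or_ge ℓ 2 with hℓ | hℓ
  · interval_cases ℓ
    · simp [(minimalPeriod_pos σ _).ne']
    · have h1 : σ.cycleType.count 1 = 0 :=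
        Multiset.count_eq_zero.2 fun h => absurd (Equiv.Perm.two_le_of_mem_cycleType h) (by simp)
      have h2 : (univ.filter fun x => minimalPeriod σ x = 1) = σ.supportᶜ := by
        ext x
        simp [minimalPeriod_eq_one_iff_isFixedPt, IsFixedPt]
      rw [h2, card_compl, Equiv.Perm.parts_partition, Multiset.count_add, h1,
        Multiset.count_replicate_self]
      simp
  · have h1 : σ.partition.parts.count ℓ =
        (σ.cycleFactorsFinset.filter fun c => c.support.card = ℓ).card := by
      rw [Equiv.Perm.parts_partition, Multiset.count_add, Multiset.count_replicate,
        if_neg (by omega), add_zero, Equiv.Perm.cycleType_def, Multiset.count_map,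
        Finset.card_def, Finset.filter_val]
      simp only [Function.comp_apply, eq_comm]
    -- Send each point to its cycle; the fibre over an `ℓ`-cycle is its support.
    rw [h1, Finset.card_eq_sum_card_fiberwise (f := σ.cycleOf)
      (t := σ.cycleFactorsFinset.filter fun c => c.support.card = ℓ), mul_comm, ← smul_eq_mul]
    · refine Finset.sum_const_nat fun c hc => ?_
      rw [mem_filter] at hc
      rw [← hc.2]
      congr 1
      ext x
      simp only [mem_filter, mem_univ, true_and]
      constructor
      · rintro ⟨hx, rfl⟩
        rw [Equiv.Perm.mem_support_cycleOf_iff]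
        refine ⟨Equiv.Perm.SameCycle.refl _ _, ?_⟩
        rw [← Equiv.Perm.cycleOf_mem_cycleFactorsFinset_iff]
        exact hc.1
      · intro hx
        have := Equiv.Perm.cycle_is_cycleOf hx hc.1
        refine ⟨?_, this.symm⟩
        rw [this, card_support_cycleOf σ]
        rw [← Equiv.Perm.mem_support, ← Equiv.Perm.cycleOf_mem_cycleFactorsFinset_iff, ← this]
        exact hc.1
    · intro x hx
      simp only [coe_filter, mem_univ, true_and, Set.mem_ofPred_eq] at hx ⊢
      have hx' : σ x ≠ x := fun h => by
        rw [minimalPeriod_eq_one_iff_isFixedPt.2 h] at hx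
        omega
      refine ⟨?_, (card_support_cycleOf σ hx').trans hx⟩
      rwa [Equiv.Perm.cycleOf_mem_cycleFactorsFinset_iff, Equiv.Perm.mem_support]

/-- Raising to the power `k` breaks an `m`-cycle into `gcd(m,k)` cycles of equal length. -/
theorem count_partition_pow (τ : Equiv.Perm α) {k ℓ : ℕ} (hk : 0 < k) (hℓ : 0 < ℓ) :
    (τ ^ k).partition.parts.count ℓ =
      ∑ m ∈ Icc 1 (Fintype.card α) with m / m.gcd k = ℓ,
        m.gcd k * τ.partition.parts.count m := by
  -- After multiplication by `ℓ` both sides count points of period `ℓ` under `τ ^ k`, sorted on the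
  -- right by their period `m` under `τ`.
  refine Nat.eq_of_mul_eq_mul_left hℓ ?_
  rw [← card_minimalPeriod_eq, mul_sum, Finset.card_eq_sum_card_fiberwise
    (f := minimalPeriod τ) (t := (Icc 1 (Fintype.card α)).filter fun m => m / m.gcd k = ℓ)]
  · refine sum_congr rfl fun m hm => ?_
    rw [mem_filter] at hm
    obtain ⟨hm, rfl⟩ := hm
    rw [← mul_assoc, Nat.div_mul_cancel (Nat.gcd_dvd_left m k), ← card_minimalPeriod_eq]
    congr 1
    ext x
    simp only [mem_filter, mem_univ, true_and, and_iff_right_iff_imp]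
    rintro rfl
    rw [← Equiv.Perm.iterate_eq_pow, minimalPeriod_iterate_eq_div_gcd hk.ne']
  · intro x hx
    simp only [coe_filter, mem_univ, true_and, Set.mem_ofPred_eq, mem_Icc] at hx ⊢
    rw [← Equiv.Perm.iterate_eq_pow, minimalPeriod_iterate_eq_div_gcd hk.ne'] at hx
    exact ⟨⟨minimalPeriod_pos τ x, minimalPeriod_le_card τ x⟩, hx⟩

end Perm

/-! ### Partitions through multiplicities -/

section Partition

variable {N : ℕ}

theorem mem_Icc_of_mem_parts (p : N.Partition) {m : ℕ} (hm : m ∈ p.parts) : m ∈ Icc 1 N := by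
  refine mem_Icc.2 ⟨p.parts_pos hm, ?_⟩
  calc m ≤ p.parts.sum := Multiset.le_sum_of_mem hm
    _ = N := p.parts_sum

theorem sum_map_parts {M : Type*} [AddCommMonoid M] (p : N.Partition) (f : ℕ → M) :
    (p.parts.map f).sum = ∑ m ∈ Icc 1 N, p.parts.count m • f m := by
  rw [Finset.sum_multiset_map_count]
  refine Finset.sum_subset (fun m hm => mem_Icc_of_mem_parts p (Multiset.mem_toFinset.1 hm)) ?_
  intro m _ hm
  rw [Multiset.mem_toFinset] at hm
  simp [Multiset.count_eq_zero.2 hm]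

theorem prod_map_parts {M : Type*} [CommMonoid M] (p : N.Partition) (f : ℕ → M) :
    (p.parts.map f).prod = ∏ m ∈ Icc 1 N, f m ^ p.parts.count m := by
  rw [Finset.prod_multiset_map_count]
  refine Finset.prod_subset (fun m hm => mem_Icc_of_mem_parts p (Multiset.mem_toFinset.1 hm)) ?_
  intro m _ hm
  rw [Multiset.mem_toFinset] at hm
  simp [Multiset.count_eq_zero.2 hm]

theorem prod_factorial_count (p : N.Partition) :
    ∏ m ∈ p.parts.toFinset, (p.parts.count m).factorial =
      ∏ m ∈ Icc 1 N, (p.parts.count m).factorial := by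
  refine Finset.prod_subset (fun m hm => mem_Icc_of_mem_parts p (Multiset.mem_toFinset.1 hm)) ?_
  intro m _ hm
  rw [Multiset.mem_toFinset] at hm
  simp [Multiset.count_eq_zero.2 hm]

theorem sum_mul_count_parts (p : N.Partition) : ∑ m ∈ Icc 1 N, m * p.parts.count m = N := by
  have h := sum_map_parts p id
  rw [Multiset.map_id, p.parts_sum] at h
  simpa [mul_comm] using h.symm

theorem filter_not_two_le (p : N.Partition) :
    (p.parts.filter fun m => ¬ 2 ≤ m) = Multiset.replicate (p.parts.count 1) 1 := by
  rw [← Multiset.filter_eq']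
  refine Multiset.filter_congr fun m hm => ?_
  have := p.parts_pos hm
  omega

theorem count_one_parts (p : N.Partition) :
    p.parts.count 1 = N - (p.parts.filter fun m => 2 ≤ m).sum := by
  have h := congrArg Multiset.sum (Multiset.filter_add_not (fun m => 2 ≤ m) p.parts)
  rw [Multiset.sum_add, filter_not_two_le, p.parts_sum, Multiset.sum_replicate] at h
  simp only [smul_eq_mul, mul_one] at h
  omega

/-- The parts equal to 1 are determined by the others and the total `N`. This links `cycleType`,
which omits fixed points, to `partition`. -/
theorem partition_ext {p q : N.Partition}
    (h : (p.parts.filter fun m => 2 ≤ m) = q.parts.filter fun m => 2 ≤ m) : p = q := by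
  refine Nat.Partition.ext ?_
  rw [← Multiset.filter_add_not (fun m => 2 ≤ m) p.parts,
    ← Multiset.filter_add_not (fun m => 2 ≤ m) q.parts, filter_not_two_le, filter_not_two_le,
    count_one_parts, count_one_parts, h]

/-- The order of the centralizer of a permutation of cycle type `p`. -/
def centralizerCard (p : N.Partition) : ℕ :=
  ∏ m ∈ Icc 1 N, m ^ p.parts.count m * (p.parts.count m).factorial

theorem centralizerCard_pos (p : N.Partition) : 0 < centralizerCard p :=
  Finset.prod_pos fun _ hm =>
    Nat.mul_pos (Nat.pow_pos (mem_Icc.1 hm).1) (Nat.factorial_pos _)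

end Partition

/-! ### Conjugacy classes: existence, size and sign -/

section Class

variable {α : Type*} [Fintype α] [DecidableEq α]

theorem partition_eq_iff (σ : Equiv.Perm α) (p : (Fintype.card α).Partition) :
    σ.partition = p ↔ σ.cycleType = p.parts.filter fun m => 2 ≤ m := by
  constructor
  · rintro rfl
    exact Equiv.Perm.filter_parts_partition_eq_cycleType.symm
  · intro h
    exact partition_ext (Equiv.Perm.filter_parts_partition_eq_cycleType.trans h)

theorem cycleType_condition {N : ℕ} (p : N.Partition) :
    (p.parts.filter fun m => 2 ≤ m).sum ≤ N ∧
      ∀ a ∈ p.parts.filter fun m => 2 ≤ m, 2 ≤ a := by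
  refine ⟨?_, fun a ha => (Multiset.mem_filter.1 ha).2⟩
  have h := congrArg Multiset.sum (Multiset.filter_add_not (fun m => 2 ≤ m) p.parts)
  rw [Multiset.sum_add, p.parts_sum] at h
  omega

theorem exists_partition_eq (p : (Fintype.card α).Partition) :
    ∃ σ : Equiv.Perm α, σ.partition = p := by
  obtain ⟨σ, hσ⟩ := (Equiv.Perm.exists_with_cycleType_iff α).2 (cycleType_condition p)
  exact ⟨σ, (partition_eq_iff σ p).2 hσ⟩

theorem card_partition_eq_mul (p : (Fintype.card α).Partition) :
    (univ.filter fun σ : Equiv.Perm α => σ.partition = p).card * centralizerCard p =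
      (Fintype.card α).factorial := by
  -- This formula treats fixed points separately; their factorial becomes the factor `m = 1` of the
  -- centralizer order.
  have h := Equiv.Perm.card_of_cycleType_mul_eq α (p.parts.filter fun m => 2 ≤ m)
  rw [if_pos (cycleType_condition p), ← count_one_parts] at h
  simp only [partition_eq_iff]
  rw [← h]
  congr 1
  have h1 : p.parts.prod = (p.parts.filter fun m => 2 ≤ m).prod := by
    conv_lhs => rw [← Multiset.filter_add_not (fun m => 2 ≤ m) p.parts, filter_not_two_le]
    simp
  have h2 : ∏ m ∈ p.parts.toFinset, (p.parts.count m).factorial =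
      (p.parts.count 1).factorial * ∏ m ∈ (p.parts.filter fun m => 2 ≤ m).toFinset,
        ((p.parts.filter fun m => 2 ≤ m).count m).factorial := by
    have h3 : ∏ m ∈ p.parts.toFinset, (p.parts.count m).factorial =
        ∏ m ∈ insert 1 (p.parts.filter fun m => 2 ≤ m).toFinset,
          (p.parts.count m).factorial := by
      refine Finset.prod_subset ?_ ?_
      · intro m hm
        have hm := Multiset.mem_toFinset.1 hm
        have := p.parts_pos hm
        simp only [mem_insert, Multiset.mem_toFinset, Multiset.mem_filter, hm, true_and]
        omega
      · intro m _ hm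
        rw [Multiset.mem_toFinset] at hm
        simp [Multiset.count_eq_zero.2 hm]
    rw [h3, Finset.prod_insert (by simp)]
    congr 1
    refine Finset.prod_congr rfl fun m hm => ?_
    rw [Multiset.count_filter_of_pos (Multiset.mem_filter.1 (Multiset.mem_toFinset.1 hm)).2]
  rw [centralizerCard, Finset.prod_mul_distrib, ← prod_factorial_count, h2, ← h1]
  have h4 := prod_map_parts p id
  rw [Multiset.map_id] at h4
  rw [h4]
  simp only [id]
  ring

theorem sign_eq_prod_parts (σ : Equiv.Perm α) :
    ((Equiv.Perm.sign σ : ℤ) : ℚ) = (σ.partition.parts.map fun m => (-1 : ℚ) ^ (m + 1)).prod := by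
  rw [Equiv.Perm.sign_of_cycleType', Equiv.Perm.parts_partition]
  induction σ.cycleType using Multiset.induction_on with
  | empty => simp
  | cons a s ih =>
    simp only [Multiset.map_cons, Multiset.prod_cons, Multiset.cons_add] at ih ⊢
    rw [← ih]
    push_cast
    ring

end Class

/-! ### Cycle types of powers as exponent vectors -/

/-- The monomial contributed by an `m`-cycle to the cycle type of a `k`th power. -/
noncomputable def powVec (k m : ℕ) : ℕ+ →₀ ℕ :=
  Finsupp.single (m / m.gcd k).toPNat' (m.gcd k)

/-- The exponent vector recording the cycle type of the `k`th power of a permutation of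
cycle type `p`. -/
noncomputable def typeVec {N : ℕ} (k : ℕ) (p : N.Partition) : ℕ+ →₀ ℕ :=
  ∑ m ∈ Icc 1 N, p.parts.count m • powVec k m

theorem div_gcd_pos {m : ℕ} (hm : 0 < m) (k : ℕ) : 0 < m / m.gcd k :=
  Nat.div_pos (Nat.le_of_dvd hm (Nat.gcd_dvd_left m k)) (Nat.gcd_pos_of_pos_left k hm)

theorem typeVec_apply {N : ℕ} (k : ℕ) (p : N.Partition) (ℓ : ℕ+) :
    typeVec k p ℓ = ∑ m ∈ Icc 1 N with m / m.gcd k = (ℓ : ℕ), m.gcd k * p.parts.count m := by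
  rw [typeVec, Finsupp.finsetSum_apply, Finset.sum_filter]
  refine Finset.sum_congr rfl fun m hm => ?_
  have hm := div_gcd_pos (mem_Icc.1 hm).1 k
  rw [powVec, Finsupp.smul_apply, Finsupp.single_apply, smul_eq_mul]
  have : (m / m.gcd k).toPNat' = ℓ ↔ m / m.gcd k = (ℓ : ℕ) := by
    rw [← PNat.coe_inj, Nat.toPNat'_coe, if_pos hm]
  simp only [this]
  split_ifs <;> ring

theorem typeVec_one_apply {N : ℕ} (p : N.Partition) (ℓ : ℕ+) :
    typeVec 1 p ℓ = p.parts.count (ℓ : ℕ) := by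
  rw [typeVec_apply]
  simp only [Nat.gcd_one_right, Nat.div_one, one_mul]
  rw [Finset.sum_filter, Finset.sum_ite_eq']
  split_ifs with h
  · rfl
  · exact (Multiset.count_eq_zero.2 fun h' => h (mem_Icc_of_mem_parts p h')).symm

theorem typeVec_one_injective {N : ℕ} :
    Function.Injective (typeVec 1 : N.Partition → ℕ+ →₀ ℕ) := by
  intro p q h
  refine Nat.Partition.ext (Multiset.ext.2 fun m => ?_)
  rcases Nat.eq_zero_or_pos m with rfl | hm
  · rw [Multiset.count_eq_zero.2 fun h => (p.parts_pos h).ne' rfl,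
      Multiset.count_eq_zero.2 fun h => (q.parts_pos h).ne' rfl]
  · lift m to ℕ+ using hm
    rw [← typeVec_one_apply, ← typeVec_one_apply, h]

theorem typeVec_partition_pow {α : Type*} [Fintype α] [DecidableEq α] (τ : Equiv.Perm α)
    {k : ℕ} (hk : 0 < k) : typeVec 1 (τ ^ k).partition = typeVec k τ.partition := by
  ext ℓ
  rw [typeVec_one_apply, typeVec_apply, count_partition_pow τ hk ℓ.pos]

/-! ### Signed count of roots by averaging over a class -/

/-- The sum of the signs of the `k`th roots. -/
noncomputable def signedRoots {α : Type*} [Fintype α] [DecidableEq α] (k : ℕ)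
    (σ : Equiv.Perm α) : ℚ :=
  ∑ τ : Equiv.Perm α with τ ^ k = σ, ((Equiv.Perm.sign τ : ℤ) : ℚ)

theorem signedRoots_conj {α : Type*} [Fintype α] [DecidableEq α] (k : ℕ)
    (σ g : Equiv.Perm α) : signedRoots k (g * σ * g⁻¹) = signedRoots k σ := by
  symm
  refine Finset.sum_equiv (MulAut.conj g).toEquiv (fun τ => ?_) (fun τ _ => ?_)
  · simp only [mem_filter, mem_univ, true_and, MulEquiv.toEquiv_eq_coe, EquivLike.coe_coe]
    rw [← map_pow, ← MulAut.conj_apply g σ, EmbeddingLike.apply_eq_iff_eq]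
  · simp [Equiv.Perm.sign_mul, mul_right_comm]

theorem signedRoots_eq {α : Type*} [Fintype α] [DecidableEq α] {k : ℕ} (hk : 0 < k)
    (σ : Equiv.Perm α) :
    signedRoots k σ = centralizerCard σ.partition *
      ∑ p : (Fintype.card α).Partition with typeVec k p = typeVec 1 σ.partition,
        (p.parts.map fun m => (-1 : ℚ) ^ (m + 1)).prod / centralizerCard p := by
  have hcard (p : (Fintype.card α).Partition) :
      ((univ.filter fun σ : Equiv.Perm α => σ.partition = p).card : ℚ) * centralizerCard p =
        (Fintype.card α).factorial := by
    exact_mod_cast card_partition_eq_mul p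
  have hz (p : (Fintype.card α).Partition) : (centralizerCard p : ℚ) ≠ 0 := by
    exact_mod_cast (centralizerCard_pos p).ne'
  have hN : ((Fintype.card α).factorial : ℚ) ≠ 0 := by
    exact_mod_cast (Nat.factorial_pos _).ne'
  have h1 : ∑ ρ : Equiv.Perm α with ρ.partition = σ.partition, signedRoots k ρ =
      (univ.filter fun ρ : Equiv.Perm α => ρ.partition = σ.partition).card *
        signedRoots k σ := by
    rw [← nsmul_eq_mul]
    refine Finset.sum_eq_card_nsmul fun ρ hρ => ?_
    rw [mem_filter, ← Equiv.Perm.partition_eq_of_isConj] at hρ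
    obtain ⟨g, rfl⟩ := isConj_iff.1 hρ.2.symm
    exact signedRoots_conj k σ g
  -- Exchange the sums: every `τ` whose `k`th power lies in the class is a root of exactly one `ρ`.
  have h2 : ∑ ρ : Equiv.Perm α with ρ.partition = σ.partition, signedRoots k ρ =
      ∑ τ : Equiv.Perm α with typeVec k τ.partition = typeVec 1 σ.partition,
        ((Equiv.Perm.sign τ : ℤ) : ℚ) := by
    rw [← Finset.sum_fiberwise_of_maps_to (g := fun τ : Equiv.Perm α => τ ^ k)
      (s := univ.filter fun τ => typeVec k τ.partition = typeVec 1 σ.partition)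
      (t := univ.filter fun ρ : Equiv.Perm α => ρ.partition = σ.partition)]
    · refine Finset.sum_congr rfl fun ρ hρ => Finset.sum_congr ?_ fun _ _ => rfl
      rw [mem_filter] at hρ
      ext τ
      simp only [mem_filter, mem_univ, true_and, iff_and_self]
      rintro rfl
      rw [← typeVec_partition_pow τ hk, hρ.2]
    · intro τ hτ
      simp only [mem_filter, mem_univ, true_and] at hτ ⊢
      rw [← typeVec_partition_pow τ hk] at hτ
      exact typeVec_one_injective hτ
  have h3 : ∑ τ : Equiv.Perm α with typeVec k τ.partition = typeVec 1 σ.partition,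
        ((Equiv.Perm.sign τ : ℤ) : ℚ) =
      ∑ p : (Fintype.card α).Partition with typeVec k p = typeVec 1 σ.partition,
        (Fintype.card α).factorial *
          ((p.parts.map fun m => (-1 : ℚ) ^ (m + 1)).prod / centralizerCard p) := by
    rw [← Finset.sum_fiberwise_of_maps_to (g := fun τ : Equiv.Perm α => τ.partition)
      (t := univ.filter fun p => typeVec k p = typeVec 1 σ.partition)]
    · refine Finset.sum_congr rfl fun p hp => ?_
      rw [mem_filter] at hp
      rw [← hcard p]
      have : (univ.filter fun τ : Equiv.Perm α =>
          typeVec k τ.partition = typeVec 1 σ.partition).filter (fun τ => τ.partition = p) =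
            univ.filter fun τ : Equiv.Perm α => τ.partition = p := by
        ext τ
        simp only [mem_filter, mem_univ, true_and, and_iff_right_iff_imp]
        rintro rfl
        exact hp.2
      rw [this, Finset.sum_congr rfl (g := fun _ =>
        (p.parts.map fun m => (-1 : ℚ) ^ (m + 1)).prod), Finset.sum_const, nsmul_eq_mul]
      · field_simp [hz p]
      · intro τ hτ
        rw [sign_eq_prod_parts, (mem_filter.1 hτ).2]
    · intro τ hτ
      simpa using hτ
  rw [h2, h3, ← Finset.mul_sum] at h1
  have h4 := hcard σ.partition
  refine mul_left_cancel₀ hN ?_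
  rw [mul_left_comm, h1, ← h4]
  ring

/-! ### Coefficients of the exponential series -/

/-- The coefficient of the monomial contributed by `m`-cycles to the exponent. -/
def cycleCoeff (k m : ℕ) : ℚ :=
  (-1) ^ (m + 1) * (((m / m.gcd k : ℕ) : ℚ) ^ m.gcd k / m)

/-- The weight giving `t_ℓ` the degree `ℓ`. -/
noncomputable def totalSize : (ℕ+ →₀ ℕ) →+ ℕ := Finsupp.weight fun ℓ : ℕ+ => (ℓ : ℕ)

theorem totalSize_single (ℓ : ℕ+) (g : ℕ) : totalSize (Finsupp.single ℓ g) = g * ℓ := by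
  rw [totalSize, Finsupp.weight_single, smul_eq_mul]

theorem totalSize_mono {d e : ℕ+ →₀ ℕ} (h : e ≤ d) : totalSize e ≤ totalSize d := by
  obtain ⟨f, rfl⟩ := exists_add_of_le h
  rw [map_add]
  exact Nat.le_add_right _ _

theorem totalSize_powVec (k : ℕ) {m : ℕ} (hm : 0 < m) : totalSize (powVec k m) = m := by
  rw [powVec, totalSize_single, Nat.toPNat'_coe, if_pos (div_gcd_pos hm k),
    Nat.mul_div_cancel' (Nat.gcd_dvd_left m k)]

theorem totalSize_sum_powVec (k N : ℕ) (μ : ℕ → ℕ) :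
    totalSize (∑ m ∈ Icc 1 N, μ m • powVec k m) = ∑ m ∈ Icc 1 N, m * μ m := by
  rw [map_sum]
  refine Finset.sum_congr rfl fun m hm => ?_
  rw [map_nsmul, totalSize_powVec k (mem_Icc.1 hm).1, smul_eq_mul, mul_comm]

theorem totalSize_typeVec {N : ℕ} (k : ℕ) (p : N.Partition) : totalSize (typeVec k p) = N := by
  rw [typeVec, totalSize_sum_powVec, sum_mul_count_parts]

theorem toPNat'_div_gcd_eq_iff {k m : ℕ} (hm : 0 < m) (ℓ : ℕ+) :
    (m / m.gcd k).toPNat' = ℓ ↔ m / m.gcd k = (ℓ : ℕ) := by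
  rw [← PNat.coe_inj, Nat.toPNat'_coe, if_pos (div_gcd_pos hm k)]

theorem coeff_inner {k N : ℕ} (hk : 0 < k) (ℓ : ℕ+) {e : ℕ+ →₀ ℕ} (he : totalSize e ≤ N) :
    MvPowerSeries.coeff e (inner k ℓ) =
      ∑ m ∈ Icc 1 N with (m / m.gcd k).toPNat' = ℓ,
        if e = powVec k m then cycleCoeff k m else 0 := by
  classical
  have hterm (g : ℕ) : MvPowerSeries.coeff e (MvPowerSeries.C
      ((-1 : ℚ) ^ ((ℓ : ℕ) * g + 1) * ((ℓ : ℚ) ^ (g - 1) / (g : ℚ))) *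
        MvPowerSeries.X ℓ ^ g) = if e = Finsupp.single ℓ g then
      (-1 : ℚ) ^ ((ℓ : ℕ) * g + 1) * ((ℓ : ℚ) ^ (g - 1) / (g : ℚ)) else 0 := by
    rw [MvPowerSeries.coeff_C_mul, MvPowerSeries.coeff_X_pow, mul_ite, mul_one, mul_zero]
  rw [inner, finsum_mem_eq_finite_toFinset_sum _ (G_finite hk ℓ), map_sum]
  simp only [hterm]
  -- Only `t_ℓ^g` with `gℓ ≤ N` can match `e`; then `g ↦ gℓ` has inverse `m ↦ gcd(m,k)`.
  rw [← Finset.sum_filter_of_ne (p := fun g => g * (ℓ : ℕ) ≤ N)]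
  · refine Finset.sum_nbij' (fun g => g * (ℓ : ℕ)) (fun m => m.gcd k) ?_ ?_ ?_ ?_ ?_
    · intro g hg
      simp only [mem_filter, Set.Finite.mem_toFinset, mem_Icc] at hg ⊢
      obtain ⟨⟨hg0, hg⟩, hN⟩ := hg
      have hpos : 0 < g * (ℓ : ℕ) := Nat.mul_pos hg0 ℓ.pos
      refine ⟨⟨hpos, hN⟩, ?_⟩
      rw [toPNat'_div_gcd_eq_iff hpos, hg, Nat.mul_div_cancel_left _ hg0]
    · intro m hm
      simp only [mem_filter, Set.Finite.mem_toFinset, mem_Icc] at hm ⊢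
      obtain ⟨⟨hm0, hN⟩, hℓ⟩ := hm
      rw [toPNat'_div_gcd_eq_iff hm0] at hℓ
      rw [← hℓ, Nat.mul_div_cancel' (Nat.gcd_dvd_left m k)]
      refine ⟨⟨Nat.gcd_pos_of_pos_left k hm0, ?_⟩, hN⟩
      rw [Nat.mul_div_cancel' (Nat.gcd_dvd_left m k)]
    · intro g hg
      simp only [mem_filter, Set.Finite.mem_toFinset] at hg
      exact hg.1.2
    · intro m hm
      simp only [mem_filter, mem_Icc] at hm
      obtain ⟨⟨hm0, hN⟩, hℓ⟩ := hm
      rw [toPNat'_div_gcd_eq_iff hm0] at hℓ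
      rw [← hℓ, Nat.mul_div_cancel' (Nat.gcd_dvd_left m k)]
    · intro g hg
      simp only [mem_filter, Set.Finite.mem_toFinset] at hg
      obtain ⟨⟨hg0, hg⟩, -⟩ := hg
      have hpos : 0 < g * (ℓ : ℕ) := Nat.mul_pos hg0 ℓ.pos
      have hdiv : g * (ℓ : ℕ) / g = ℓ := Nat.mul_div_cancel_left _ hg0
      have hv : powVec k (g * ℓ) = Finsupp.single ℓ g := by
        have h := (toPNat'_div_gcd_eq_iff (k := k) hpos ℓ).2 (by rw [hg, hdiv])
        rw [powVec, h, hg]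
      have hc : cycleCoeff k (g * ℓ) =
          (-1 : ℚ) ^ ((ℓ : ℕ) * g + 1) * ((ℓ : ℚ) ^ (g - 1) / (g : ℚ)) := by
        have hℓ0 : ((ℓ : ℕ) : ℚ) ≠ 0 := by exact_mod_cast ℓ.ne_zero
        rw [cycleCoeff, hg, hdiv, mul_comm g (ℓ : ℕ)]
        congr 1
        obtain ⟨g, rfl⟩ := Nat.exists_eq_succ_of_ne_zero hg0.ne'
        rw [Nat.succ_sub_one, pow_succ, Nat.cast_mul, mul_comm _ ((ℓ : ℕ) : ℚ),
          mul_div_mul_left _ _ hℓ0]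
      rw [hv, hc]
  · intro g _ h
    have h : e = Finsupp.single ℓ g := by
      by_contra h'
      exact h (if_neg h')
    rwa [h, totalSize_single] at he

/-- The part of the exponent of total size at most `N`. -/
noncomputable def truncExponent (k N : ℕ) : MvPowerSeries ℕ+ ℚ :=
  ∑ m ∈ Icc 1 N, MvPowerSeries.monomial (powVec k m) (cycleCoeff k m)

theorem coeff_exponent {k N : ℕ} (hk : 0 < k) {e : ℕ+ →₀ ℕ} (he : totalSize e ≤ N) :
    MvPowerSeries.coeff e (exponent k) = MvPowerSeries.coeff e (truncExponent k N) := by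
  classical
  have h := (MvPowerSeries.WithPiTopology.hasSum_iff_hasSum_coeff).1 (hasSum_inner hk) e
  simp only [coeff_inner hk _ he] at h
  refine (h.unique (hasSum_sum_of_ne_finset_zero
    (s := (Icc 1 N).image fun m => (m / m.gcd k).toPNat') ?_)).trans ?_
  · intro ℓ hℓ
    rw [Finset.filter_eq_empty_iff.2, Finset.sum_empty]
    intro m hm hm'
    exact hℓ (mem_image.2 ⟨m, hm, hm'⟩)
  · rw [Finset.sum_fiberwise_of_maps_to fun m hm => mem_image_of_mem _ hm, truncExponent, map_sum]
    simp only [MvPowerSeries.coeff_monomial]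

/-- `f - g` divides `f ^ j - g ^ j`, and it has no coefficients at or below `d`. This permits
truncating the exponent to a finite sum. -/
theorem coeff_pow_congr {σ R : Type*} [CommRing R] {f g : MvPowerSeries σ R} {d : σ →₀ ℕ}
    (h : ∀ e ≤ d, MvPowerSeries.coeff e f = MvPowerSeries.coeff e g) (j : ℕ) :
    MvPowerSeries.coeff d (f ^ j) = MvPowerSeries.coeff d (g ^ j) := by
  classical
  obtain ⟨q, hq⟩ := sub_dvd_pow_sub_pow f g j
  rw [← sub_eq_zero, ← map_sub, hq, MvPowerSeries.coeff_mul]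
  refine Finset.sum_eq_zero fun x hx => ?_
  rw [map_sub, h x.1 (mem_antidiagonal.1 hx ▸ le_self_add), sub_self, zero_mul]

theorem monomial_pow' {σ R : Type*} [CommSemiring R] (e : σ →₀ ℕ) (a : R) (j : ℕ) :
    MvPowerSeries.monomial e a ^ j = MvPowerSeries.monomial (j • e) (a ^ j) := by
  induction j with
  | zero => simp [MvPowerSeries.monomial_zero_one]
  | succ j ih => rw [pow_succ, ih, MvPowerSeries.monomial_mul_monomial, succ_nsmul, pow_succ]

theorem prod_monomial {ι σ R : Type*} [CommSemiring R] (s : Finset ι) (e : ι → σ →₀ ℕ)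
    (a : ι → R) : ∏ i ∈ s, MvPowerSeries.monomial (e i) (a i) =
      MvPowerSeries.monomial (∑ i ∈ s, e i) (∏ i ∈ s, a i) := by
  classical
  induction s using Finset.induction_on with
  | empty => simp [MvPowerSeries.monomial_zero_one]
  | insert i s hi ih =>
    rw [prod_insert hi, ih, MvPowerSeries.monomial_mul_monomial, sum_insert hi, prod_insert hi]

theorem coeff_truncExponent_pow (k N j : ℕ) (d : ℕ+ →₀ ℕ) :
    (j.factorial : ℚ)⁻¹ * MvPowerSeries.coeff d (truncExponent k N ^ j) =
      ∑ μ ∈ (Icc 1 N).piAntidiag j with ∑ m ∈ Icc 1 N, μ m • powVec k m = d,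
        ∏ m ∈ Icc 1 N, cycleCoeff k m ^ μ m / (μ m).factorial := by
  classical
  rw [truncExponent, Finset.sum_pow_eq_sum_piAntidiag, map_sum, Finset.mul_sum,
    Finset.sum_filter]
  refine Finset.sum_congr rfl fun μ hμ => ?_
  have hspec := Nat.multinomial_spec (Icc 1 N) μ
  rw [(mem_piAntidiag.1 hμ).1] at hspec
  simp only [monomial_pow']
  rw [prod_monomial, ← map_natCast (MvPowerSeries.C (σ := ℕ+) (R := ℚ)),
    MvPowerSeries.coeff_C_mul, MvPowerSeries.coeff_monomial]
  simp only [eq_comm (a := d)]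
  split_ifs with h
  · have hprod : (∏ m ∈ Icc 1 N, ((μ m).factorial : ℚ)) ≠ 0 :=
      Finset.prod_ne_zero_iff.2 fun m _ => by exact_mod_cast (Nat.factorial_pos _).ne'
    have hmul : (Nat.multinomial (Icc 1 N) μ : ℚ) ≠ 0 := by
      exact_mod_cast (Nat.multinomial_pos _ _).ne'
    rw [← hspec, Finset.prod_div_distrib]
    push_cast
    field_simp
  · ring

theorem coeff_genSeries {k N : ℕ} (hk : 0 < k) {d : ℕ+ →₀ ℕ} (hd : totalSize d = N) :
    MvPowerSeries.coeff d (genSeries k) = ∑ p : N.Partition with typeVec k p = d,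
      ∏ m ∈ Icc 1 N, cycleCoeff k m ^ p.parts.count m / (p.parts.count m).factorial := by
  classical
  have hterm (j : ℕ) : PowerSeries.coeff j (PowerSeries.exp ℚ) •
      MvPowerSeries.coeff d (exponent k ^ j) =
      ∑ μ ∈ (Icc 1 N).piAntidiag j with ∑ m ∈ Icc 1 N, μ m • powVec k m = d,
        ∏ m ∈ Icc 1 N, cycleCoeff k m ^ μ m / (μ m).factorial := by
    rw [← coeff_truncExponent_pow, coeff_pow_congr (g := truncExponent k N)
      fun e he => coeff_exponent hk (hd ▸ totalSize_mono he)]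
    simp [PowerSeries.coeff_exp]
  rw [genSeries, PowerSeries.coeff_subst (hasSubst_exponent hk)]
  simp only [hterm]
  -- Each monomial has size at least 1, so powers `j > N` do not reach size `N`; `j` is the number
  -- of parts.
  rw [finsum_eq_sum_of_support_subset (s := Finset.range (N + 1)), Finset.sum_sigma']
  · symm
    refine Finset.sum_bij (fun p _ => ⟨p.parts.card, fun m => p.parts.count m⟩) ?_ ?_ ?_ ?_
    · intro p hp
      have hp : typeVec k p = d := (mem_filter.1 hp).2
      have hcard : ∑ m ∈ Icc 1 N, p.parts.count m = p.parts.card := by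
        have := sum_map_parts p fun _ => 1
        simpa using this.symm
      simp only [mem_sigma, mem_filter, mem_range, mem_piAntidiag]
      refine ⟨?_, ⟨hcard, fun m hm => ?_⟩, hp⟩
      · rw [Nat.lt_succ_iff, ← hcard]
        calc _ ≤ ∑ m ∈ Icc 1 N, m * p.parts.count m :=
              Finset.sum_le_sum fun m hm => Nat.le_mul_of_pos_left _ (mem_Icc.1 hm).1
          _ = N := sum_mul_count_parts p
      · exact mem_Icc_of_mem_parts p (Multiset.count_ne_zero.1 hm)
    · intro p _ q _ h
      simp only [Sigma.mk.injEq] at h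
      exact Nat.Partition.ext (Multiset.ext.2 fun m => congrFun (eq_of_heq h.2) m)
    · rintro ⟨j, μ⟩ h
      simp only [mem_sigma, mem_filter, mem_range, mem_piAntidiag] at h
      obtain ⟨-, ⟨hj, hμ⟩, hv⟩ := h
      have hcount (m : ℕ) :
          (∑ i ∈ Icc 1 N, Multiset.replicate (μ i) i).count m = μ m := by
        rw [Multiset.count_sum']
        simp only [Multiset.count_replicate]
        rw [Finset.sum_ite_eq']
        split_ifs with hm
        · rfl
        · by_contra h'
          exact hm (hμ m (Ne.symm h'))
      refine ⟨⟨∑ i ∈ Icc 1 N, Multiset.replicate (μ i) i, ?_, ?_⟩, ?_, ?_⟩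
      · intro i hi
        obtain ⟨m, hm, hi⟩ := Multiset.mem_sum.1 hi
        rw [Multiset.eq_of_mem_replicate hi]
        exact (mem_Icc.1 hm).1
      · rw [← Multiset.coe_sumAddMonoidHom, map_sum]
        simp only [Multiset.coe_sumAddMonoidHom, Multiset.sum_replicate, smul_eq_mul]
        have h := totalSize_sum_powVec k N μ
        rw [hv, hd] at h
        exact (Finset.sum_congr rfl fun _ _ => mul_comm _ _).trans h.symm
      · refine mem_filter.2 ⟨mem_univ _, ?_⟩
        rw [typeVec]
        simp only [hcount, hv]
      · simp only [hcount]
        congr 1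
        rw [← hj, Multiset.card_sum]
        simp
    · intro p _
      rfl
  · intro j hj
    rw [Function.mem_support] at hj
    obtain ⟨μ, hμ, -⟩ := Finset.exists_ne_zero_of_sum_ne_zero hj
    rw [mem_filter, mem_piAntidiag] at hμ
    obtain ⟨⟨hj, -⟩, hv⟩ := hμ
    have h := totalSize_sum_powVec k N μ
    rw [hv, hd] at h
    rw [coe_range, Set.mem_Iio, Nat.lt_succ_iff, ← hj]
    exact (Finset.sum_le_sum fun m hm =>
      Nat.le_mul_of_pos_left _ (mem_Icc.1 hm).1).trans h.ge

/-! ### Comparison of the two sides -/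

/-- The product of all cycle lengths. -/
theorem prod_typeVec {N : ℕ} (k : ℕ) (p : N.Partition) :
    (typeVec k p).prod (fun ℓ a => ((ℓ : ℕ) : ℚ) ^ a) =
      ∏ m ∈ Icc 1 N, (((m / m.gcd k : ℕ) : ℚ) ^ m.gcd k) ^ p.parts.count m := by
  rw [typeVec, ← Finsupp.prod_finsetSum_index (by simp) (by intros; rw [pow_add])]
  refine Finset.prod_congr rfl fun m hm => ?_
  rw [powVec, Finsupp.smul_single, Finsupp.prod_single_index (by simp), smul_eq_mul,
    Nat.toPNat'_coe, if_pos (div_gcd_pos (mem_Icc.1 hm).1 k), mul_comm, pow_mul]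

theorem prod_cycleCoeff {N : ℕ} (k : ℕ) (p : N.Partition) :
    ∏ m ∈ Icc 1 N, cycleCoeff k m ^ p.parts.count m / (p.parts.count m).factorial =
      (typeVec k p).prod (fun ℓ a => ((ℓ : ℕ) : ℚ) ^ a) *
        ((p.parts.map fun m => (-1 : ℚ) ^ (m + 1)).prod / centralizerCard p) := by
  rw [prod_typeVec, prod_map_parts, centralizerCard]
  push_cast
  rw [← Finset.prod_div_distrib, ← Finset.prod_mul_distrib]
  refine Finset.prod_congr rfl fun m _ => ?_
  rw [cycleCoeff, mul_pow, div_pow, mul_comm, div_mul_eq_mul_div, div_div, mul_div_assoc]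

theorem centralizerCard_eq {N : ℕ} (p : N.Partition) :
    (centralizerCard p : ℚ) = (typeVec 1 p).prod (fun ℓ a => ((ℓ : ℕ) : ℚ) ^ a) *
      ∏ m ∈ Icc 1 N, ((p.parts.count m).factorial : ℚ) := by
  rw [prod_typeVec, centralizerCard]
  push_cast
  rw [Finset.prod_mul_distrib]
  simp

theorem signedRoots_eq_coeff {α : Type*} [Fintype α] [DecidableEq α] {k : ℕ} (hk : 0 < k)
    (σ : Equiv.Perm α) :
    signedRoots k σ =
      (∏ m ∈ Icc 1 (Fintype.card α), ((σ.partition.parts.count m).factorial : ℚ)) *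
        MvPowerSeries.coeff (typeVec 1 σ.partition) (genSeries k) := by
  rw [signedRoots_eq hk, coeff_genSeries hk (totalSize_typeVec 1 σ.partition),
    centralizerCard_eq, mul_right_comm, mul_comm, Finset.mul_sum]
  congr 1
  refine Finset.sum_congr rfl fun p hp => ?_
  rw [prod_cycleCoeff, (mem_filter.1 hp).2]

theorem prod_Icc_one_card_fin {M : Type*} [CommMonoid M] (n : ℕ) (f : ℕ → M) :
    ∏ m ∈ Icc 1 (Fintype.card (Fin n)), f m = ∏ i : Fin n, f ((i : ℕ) + 1) := by
  rw [Fintype.card_fin, Fin.prod_univ_eq_prod_range (fun i => f (i + 1)) n,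
    Finset.range_eq_Ico, Finset.prod_Ico_add' f 0 n 1]
  rfl

theorem typeVec_eq_monomialExp {n : ℕ} {σ : Equiv.Perm (Fin n)} {c : Fin n → ℕ}
    (h : HasCycleType σ c) : typeVec 1 σ.partition = monomialExp c := by
  ext ℓ
  rw [typeVec_one_apply, monomialExp, Finsupp.finsetSum_apply]
  simp only [Finsupp.single_apply, ← PNat.coe_inj, Nat.succPNat_coe, Nat.succ_eq_add_one]
  by_cases hℓ : (ℓ : ℕ) ≤ n
  · have hpos := ℓ.pos
    have hi : (ℓ : ℕ) - 1 + 1 = ℓ := Nat.sub_add_cancel hpos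
    rw [Finset.sum_eq_single ⟨(ℓ : ℕ) - 1, by omega⟩, if_pos hi, ← h]
    · simp only [hi]
    · intro i _ hne
      refine if_neg fun h' => hne (Fin.ext ?_)
      simp only
      omega
    · simp
  · rw [Finset.sum_eq_zero, Multiset.count_eq_zero]
    · intro h'
      have := (mem_Icc.1 (mem_Icc_of_mem_parts _ h')).2
      rw [Fintype.card_fin] at this
      exact hℓ this
    · intro i _
      exact if_neg (by omega)

theorem exists_hasCycleType {n : ℕ} {c : Fin n → ℕ} (hc : n = ∑ i : Fin n, ((i : ℕ) + 1) * c i) :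
    ∃ σ : Equiv.Perm (Fin n), HasCycleType σ c := by
  let p : (Fintype.card (Fin n)).Partition :=
    { parts := ∑ i : Fin n, Multiset.replicate (c i) ((i : ℕ) + 1)
      parts_pos := by
        intro m hm
        obtain ⟨i, -, hm⟩ := Multiset.mem_sum.1 hm
        rw [Multiset.eq_of_mem_replicate hm]
        exact Nat.succ_pos _
      parts_sum := by
        rw [← Multiset.coe_sumAddMonoidHom, map_sum, Fintype.card_fin]
        simp only [Multiset.coe_sumAddMonoidHom, Multiset.sum_replicate, smul_eq_mul]
        conv_rhs => rw [hc]
        exact Finset.sum_congr rfl fun _ _ => mul_comm _ _ }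
  obtain ⟨σ, hσ⟩ := exists_partition_eq p
  refine ⟨σ, fun i => ?_⟩
  rw [hσ, Multiset.count_sum']
  simp only [Multiset.count_replicate, Nat.add_right_cancel_iff, Fin.val_inj]
  rw [Finset.sum_ite_eq', if_pos (mem_univ i)]

theorem signedRoots_eq_re_sub_ro {n : ℕ} (k : ℕ) (σ : Equiv.Perm (Fin n)) :
    signedRoots k σ = (re k σ : ℚ) - (ro k σ : ℚ) := by
  rw [signedRoots, re, ro, ← Finset.filter_filter, ← Finset.filter_filter, Finset.card_filter,
    Finset.card_filter, Nat.cast_sum, Nat.cast_sum, ← Finset.sum_sub_distrib]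
  refine Finset.sum_congr rfl fun τ _ => ?_
  rcases Int.units_eq_one_or (Equiv.Perm.sign τ) with h | h <;> rw [h] <;> simp

end PermRoots

theorem mainTheorem2 (n k : ℕ) (hn : 0 < n) (hk : 0 < k) (c : Fin n → ℕ)
    (hc : n = ∑ i : Fin n, ((i : ℕ) + 1) * c i) :
    (∃ σ : Equiv.Perm (Fin n), PermRoots.HasCycleType σ c) ∧
    ∀ σ : Equiv.Perm (Fin n), PermRoots.HasCycleType σ c →
      PermRoots.egfCoeff c (PermRoots.genSeries k) =
        (PermRoots.re k σ : ℚ) - (PermRoots.ro k σ : ℚ) := by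
  refine ⟨PermRoots.exists_hasCycleType hc, fun σ hσ => ?_⟩
  rw [← PermRoots.signedRoots_eq_re_sub_ro, PermRoots.signedRoots_eq_coeff hk,
    PermRoots.typeVec_eq_monomialExp hσ, PermRoots.egfCoeff, PermRoots.prod_Icc_one_card_fin]
  simp only [hσ _]
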